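/- There are $N$ agents. Agent $i$ has a countable (for instance finite) state space $\mathcal S_i$, a countable (for instance finite) action space $\mathcal A_i$ with nonempty sets $\mathcal A_i(s)\subseteq\mathcal A_i$ of available actions, a designated crowded action $a_{\mathrm{crowd}}\in\mathcal A_i(s)$ for all $s$, a transition kernel $p_i(s'\mid s,a)$, an initial distribution $\beta_i$ and a bounded local utility $u_i:\mathcal S_i\times\mathcal A_i\to\mathbb R$. In every state some action other than $a_{\mathrm{crowd}}$ is available. Let $0\le\gamma<1$, and let $d:[1,\infty)\to\mathbb R$ be continuous with $d(1)=0$, twice differentiable on $(1,\infty)$, with $d'>0$ there and with $d''$ of constant (weak) sign there. For a constraint vector $\theta\in[0,\infty)^N$ put $\theta_{-i}=\sum_{j\ne i}\theta_j$, $$c_i(s,a)=\mathbb 1[a=a_{\mathrm{crowd}}],\qquad \hat r_i(s,a;\theta_{-i})=u_i(s,a)+\mathbb 1[a=a_{\mathrm{crowd}}]\,d(1+\theta_{-i}).$$ For a stationary randomized policy $\pi$ of agent $i$ (choosing available actions only), with $S_0\sim\beta_i$, $A_t\sim\pi(\cdot\mid S_t)$, $S_{t+1}\sim p_i(\cdot\mid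 S_t,A_t)$, and for $\lambda\ge 0$, let $$\mathcal L_i(\pi,\lambda;\theta)=\mathbb E_\pi\Big[\sum_{t\ge0}\gamma^t\,\hat r_i(S_t,A_t;\theta_{-i})\Big]+\lambda\Big(\mathbb E_\pi\Big[\sum_{t\ge0}\gamma^t c_i(S_t,A_t)\Big]-\theta_i\Big)$$ be the Lagrangian of the problem of minimizing the discounted reward subject to discounted cost at most $\theta_i$, and let $$\tilde J_i^\ell(\theta)=\inf_\pi\ \sup_{\lambda\ge0}\ \mathcal L_i(\pi,\lambda;\theta)$$ be the long-term Lagrangian value of agent $i$. **Lemma.** For every agent $i$, the value $\tilde J_i^\ell(\theta)$ is finite and equals $\sup_{\lambda\ge0}\inf_\pi\mathcal L_i(\pi,\lambda;\theta)$ for every $\theta\in[0,\infty)^N$ with $\theta_i>0$; and the function $\theta\mapsto\tilde J_i^\ell(\theta)$ is differentiable (jointly in all components of $\theta$) at Lebesgue-almost every $\theta\in[0,\infty)^N$. -/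

import Mathlib

open MeasureTheory ProbabilityTheory Set

/-- The assumptions on the congestion penalty `d : [1, ∞) → ℝ`: `d 1 = 0`, `d' > 0`, and `d''` exists
and does not change sign. `d` is a total function, but only its values on `[1, ∞)` are constrained;
at the end point `1` only continuity is required (so that `d n = (n - 1) ^ α`, `α > 0`, is allowed). -/
structure IsCongestionPenalty (d : ℝ → ℝ) : Prop where
  map_one : d 1 = 0
  continuousOn : ContinuousOn d (Ici 1)
  differentiableOn : DifferentiableOn ℝ d (Ioi 1)
  deriv_pos : ∀ x, 1 < x → 0 < deriv d x
  differentiableOn_deriv : DifferentiableOn ℝ (deriv d) (Ioi 1)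
  deriv_deriv_sign :
    (∀ x, 1 < x → 0 ≤ deriv (deriv d) x) ∨ (∀ x, 1 < x → deriv (deriv d) x ≤ 0)

/-- The local data of one agent: state space `S`, actions `A`, the sets `avail s` of actions available
in each state, the crowded action (always available, and never the only available one), the local
transition kernel, the initial distribution `β` and the (bounded) local utility. -/
structure Agent (S A : Type*) where
  avail : S → Set A
  crowd : A
  crowd_mem : ∀ s, crowd ∈ avail s
  exists_ne_crowd : ∀ s, ∃ a ∈ avail s, a ≠ crowd
  trans : S → A → PMF S
  init : PMF S
  utility : S → A → ℝ
  utility_bdd : ∃ M : ℝ, ∀ s a, |utility s a| ≤ M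

namespace Agent

variable {S A : Type*}

/-- Stationary randomized policies, choosing available actions only. -/
structure Policy (m : Agent S A) where
  law : S → PMF A
  support_subset : ∀ s, (law s).support ⊆ m.avail s

open Classical in
/-- The cost `c(s, a) = 𝟙[a = a_crowd]`. -/
noncomputable def cost (m : Agent S A) (x : S × A) : ℝ :=
  if x.2 = m.crowd then 1 else 0

/-- The approximated reward `u(s, a) + 𝟙[a = a_crowd] d(1 + τ)`, where `τ` is the sum of the
constraints of the other agents. -/
noncomputable def reward (m : Agent S A) (d : ℝ → ℝ) (τ : ℝ) (x : S × A) : ℝ :=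
  m.utility x.1 x.2 + m.cost x * d (1 + τ)

/-- Draw the action by the policy once the state has been drawn from `p`. -/
noncomputable def Policy.pairLaw {m : Agent S A} (π : m.Policy) (p : PMF S) : PMF (S × A) :=
  p.bind fun s => (π.law s).map (Prod.mk s)

variable [MeasurableSpace S] [MeasurableSpace A] [DiscreteMeasurableSpace S]
  [DiscreteMeasurableSpace A] [Countable S] [Countable A]

/-- One step of the chain `(S_t, A_t)` under `π`: the next state follows `trans`, the next action `π`. -/
noncomputable def Policy.step {m : Agent S A} (π : m.Policy) : Kernel (S × A) (S × A) :=
  Kernel.ofFunOfCountable fun x => (π.pairLaw (m.trans x.1 x.2)).toMeasure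

instance Policy.isMarkovKernel_step {m : Agent S A} (π : m.Policy) : IsMarkovKernel π.step :=
  ⟨fun x => by
    change IsProbabilityMeasure (π.pairLaw (m.trans x.1 x.2)).toMeasure
    infer_instance⟩

/-- The law of the trajectory `(S_t, A_t)_{t ≥ 0}` under `π`, with `S_0 ∼ init`. -/
noncomputable def Policy.pathLaw {m : Agent S A} (π : m.Policy) : Measure (ℕ → S × A) :=
  Kernel.trajMeasure (X := fun _ => S × A) (π.pairLaw m.init).toMeasure
    (fun n => π.step.comap (fun h => h ⟨n, by simp⟩) (measurable_pi_apply _))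

/-- The expected discounted sum `𝔼_π[∑ₜ γᵗ f(S_t, A_t)]`. -/
noncomputable def Policy.discounted {m : Agent S A} (π : m.Policy) (γ : ℝ) (f : S × A → ℝ) : ℝ :=
  ∫ ω, ∑' t : ℕ, γ ^ t * f (ω t) ∂π.pathLaw

end Agent

section System

variable {N : ℕ} {S A : Fin N → Type*} [∀ i, MeasurableSpace (S i)] [∀ i, MeasurableSpace (A i)]
  [∀ i, DiscreteMeasurableSpace (S i)] [∀ i, DiscreteMeasurableSpace (A i)]
  [∀ i, Countable (S i)] [∀ i, Countable (A i)]

/-- `θ₋ᵢ`, the sum of the constraints of the agents other than `i`. -/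
def othersSum (θ : Fin N → ℝ) (i : Fin N) : ℝ :=
  ∑ j ∈ Finset.univ.erase i, θ j

/-- The Lagrangian `J_i(π; θ₋ᵢ) + l (K_i(π) - θ_i)` of the problem of agent `i`: minimize the
discounted reward `J_i` subject to the discounted cost satisfying `K_i ≤ θ_i`. -/
noncomputable def lagrangian (m : ∀ i, Agent (S i) (A i)) (d : ℝ → ℝ) (γ : ℝ) (i : Fin N)
    (θ : Fin N → ℝ) (l : ℝ) (π : (m i).Policy) : ℝ :=
  π.discounted γ ((m i).reward d (othersSum θ i)) + l * (π.discounted γ (m i).cost - θ i)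

/-- The optimal value of the Lagrangian, `inf_π sup_{l ≥ 0}`, as an extended real number. -/
noncomputable def lagrangianValueE (m : ∀ i, Agent (S i) (A i)) (d : ℝ → ℝ) (γ : ℝ) (i : Fin N)
    (θ : Fin N → ℝ) : EReal :=
  ⨅ π : (m i).Policy, ⨆ l : {l : ℝ // 0 ≤ l}, (lagrangian m d γ i θ l π : EReal)

/-- The optimal value of the Lagrangian as a real number. -/
noncomputable def lagrangianValue (m : ∀ i, Agent (S i) (A i)) (d : ℝ → ℝ) (γ : ℝ) (i : Fin N)
    (θ : Fin N → ℝ) : ℝ :=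
  (lagrangianValueE m d γ i θ).toReal

end System

/-! The other agents enter agent `i`'s problem only through the number `D = d (1 + othersSum θ i)`,
and the inner supremum over multipliers enforces the constraint, so the value is `inf {U π + D * K π
| K π ≤ k}` with `k = θ i`, `U` the discounted utility and `K` the discounted cost. The pairs `(U π,
K π)` form a convex set: discounted sums are integrals against occupation measures, and a mixture of
two occupation measures is again that of a stationary policy (`Policy.exists_occupation_eq`).
Avoiding the crowded action gives `K = 0`, a Slater point for `k > 0`, hence a multiplier and strong
duality. Mixing with that same policy makes the value locally Lipschitz in `(D, k)` on `k > 0`.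
Since `d` is C¹ on `(1, ∞)`, the value is locally Lipschitz in `θ` on the open positive orthant;
Rademacher's theorem applies there, and the boundary of the orthant is null. -/

namespace Agent

/-! ### Occupation weights and the flow equation -/

variable {S A : Type*}

/-- The law of `(S_t, A_t)` under `π`. -/
noncomputable def Policy.marginal {m : Agent S A} (π : m.Policy) : ℕ → PMF (S × A)
  | 0 => π.pairLaw m.init
  | t + 1 => (π.marginal t).bind fun x => π.pairLaw (m.trans x.1 x.2)

theorem Policy.pairLaw_apply {m : Agent S A} (π : m.Policy) (p : PMF S) (x : S × A) :
    π.pairLaw p x = p x.1 * π.law x.1 x.2 := by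
  classical
  rw [Policy.pairLaw, PMF.bind_apply, tsum_eq_single x.1]
  · rw [PMF.map_apply, tsum_eq_single x.2]
    · simp
    · intro a ha
      rw [if_neg]
      rintro h
      exact ha (by rw [h])
  · intro s hs
    rw [PMF.map_apply]
    simp only [mul_eq_zero, ENNReal.tsum_eq_zero]
    right
    intro a
    rw [if_neg]
    rintro h
    exact hs (by rw [h])

/-- The discounted occupation weights `∑ₜ gᵗ ℙ_π((S_t, A_t) = x)`. -/
noncomputable def Policy.occupation {m : Agent S A} (π : m.Policy) (g : ENNReal) (x : S × A) :
    ENNReal :=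
  ∑' t, g ^ t * π.marginal t x

/-- The weight flowing into a state: the initial distribution plus the discounted transitions. -/
noncomputable def inflow (m : Agent S A) (g : ENNReal) (ν : S × A → ENNReal) (s : S) : ENNReal :=
  m.init s + g * ∑' y, ν y * m.trans y.1 y.2 s

theorem Policy.marginal_succ_apply {m : Agent S A} (π : m.Policy) (t : ℕ) (x : S × A) :
    π.marginal (t + 1) x = (∑' y, π.marginal t y * m.trans y.1 y.2 x.1) * π.law x.1 x.2 := by
  rw [Policy.marginal, PMF.bind_apply, ← ENNReal.tsum_mul_right]
  simp only [Policy.pairLaw_apply, mul_assoc]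

/-- Splitting off the term `t = 0` and exchanging sums turns the one-step recursion of the marginals
into a fixed-point equation. -/
theorem Policy.occupation_eq {m : Agent S A} (π : m.Policy) (g : ENNReal) (x : S × A) :
    π.occupation g x = m.inflow g (π.occupation g) x.1 * π.law x.1 x.2 := by
  have h : ∑' t, g ^ (t + 1) * π.marginal (t + 1) x =
      g * (∑' y, π.occupation g y * m.trans y.1 y.2 x.1) * π.law x.1 x.2 := by
    simp only [Policy.occupation, Policy.marginal_succ_apply, ← ENNReal.tsum_mul_right]
    rw [ENNReal.tsum_comm, ← ENNReal.tsum_mul_left, ← ENNReal.tsum_mul_right]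
    refine tsum_congr fun y => ?_
    rw [← ENNReal.tsum_mul_left, ← ENNReal.tsum_mul_left, ← ENNReal.tsum_mul_right]
    refine tsum_congr fun t => ?_
    ring
  rw [inflow, add_mul, ← h, Policy.occupation, tsum_eq_zero_add' ENNReal.summable]
  simp [Policy.marginal, Policy.pairLaw_apply]

theorem Policy.tsum_occupation {m : Agent S A} (π : m.Policy) (g : ENNReal) :
    ∑' x, π.occupation g x = (1 - g)⁻¹ := by
  simp only [Policy.occupation]
  rw [ENNReal.tsum_comm]
  simp [ENNReal.tsum_mul_left, PMF.tsum_coe, ENNReal.tsum_geometric]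

/-- Iterating the flow equation `n` times produces the first `n` discounted marginals plus a
nonnegative remainder. -/
theorem Policy.sum_range_marginal_le {m : Agent S A} (π : m.Policy) (g : ENNReal)
    {ν : S × A → ENNReal} (hν : ∀ x, ν x = m.inflow g ν x.1 * π.law x.1 x.2) (n : ℕ) (x : S × A) :
    ∑ t ∈ Finset.range n, g ^ t * π.marginal t x ≤ ν x := by
  induction n generalizing x with
  | zero => simp
  | succ n ih =>
    rw [Finset.sum_range_succ', hν x, inflow, add_mul, add_comm]
    refine add_le_add (by simp [Policy.marginal, Policy.pairLaw_apply]) ?_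
    calc ∑ t ∈ Finset.range n, g ^ (t + 1) * π.marginal (t + 1) x
        = g * (∑' y, (∑ t ∈ Finset.range n, g ^ t * π.marginal t y) * m.trans y.1 y.2 x.1) *
            π.law x.1 x.2 := by
          simp only [Finset.sum_mul]
          rw [Summable.tsum_finsetSum fun _ _ => ENNReal.summable, Finset.mul_sum, Finset.sum_mul]
          refine Finset.sum_congr rfl fun t _ => ?_
          rw [Policy.marginal_succ_apply, ← ENNReal.tsum_mul_right, ← ENNReal.tsum_mul_left,
            ← ENNReal.tsum_mul_left, ← ENNReal.tsum_mul_right]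
          refine tsum_congr fun y => ?_
          ring
      _ ≤ _ := by
          gcongr with y
          exact ih y

/-- The occupation weights are the only solution of the flow equation with the right total mass. -/
theorem Policy.eq_occupation {m : Agent S A} (π : m.Policy) {g : ENNReal} (hg : g < 1)
    {ν : S × A → ENNReal} (hν : ∀ x, ν x = m.inflow g ν x.1 * π.law x.1 x.2)
    (hmass : ∑' x, ν x = (1 - g)⁻¹) : ν = π.occupation g := by
  have hle : ∀ x, π.occupation g x ≤ ν x := fun x =>
    ENNReal.tsum_le_of_sum_range_le fun n => π.sum_range_marginal_le g hν n x
  have htop : (1 - g)⁻¹ ≠ ⊤ := by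
    simp [tsub_eq_zero_iff_le, hg]
  have hfin : ∑' x, π.occupation g x ≠ ⊤ := by rwa [π.tsum_occupation]
  -- The solution dominates the occupation weights and has the same finite mass, so nothing is left
  -- over.
  have h0 : ∑' x, (ν x - π.occupation g x) = 0 := by
    have h : ∑' x, π.occupation g x + ∑' x, (ν x - π.occupation g x) =
        ∑' x, π.occupation g x + 0 := by
      rw [← ENNReal.tsum_add, add_zero, π.tsum_occupation, ← hmass]
      exact tsum_congr fun x => add_tsub_cancel_of_le (hle x)
    exact (ENNReal.add_right_inj hfin).1 h
  funext x
  exact le_antisymm (tsub_eq_zero_iff_le.1 (ENNReal.tsum_eq_zero.1 h0 x)) (hle x)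

/-- A convex combination of occupation weights is the occupation weight of a stationary policy. -/
theorem Policy.exists_occupation_eq {m : Agent S A} (π₁ π₂ : m.Policy) {g : ENNReal} (hg : g < 1)
    {a b : ENNReal} (hab : a + b = 1) :
    ∃ π : m.Policy, ∀ x, π.occupation g x = a * π₁.occupation g x + b * π₂.occupation g x := by
  classical
  set ν : S × A → ENNReal := fun x => a * π₁.occupation g x + b * π₂.occupation g x with hνdef
  have hmass : ∑' x, ν x = (1 - g)⁻¹ := by
    simp only [hνdef]
    rw [ENNReal.tsum_add, ENNReal.tsum_mul_left, ENNReal.tsum_mul_left, π₁.tsum_occupation,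
      π₂.tsum_occupation, ← add_mul, hab, one_mul]
  have htop : (1 - g)⁻¹ ≠ ⊤ := by simp [tsub_eq_zero_iff_le, hg]
  have hflow : ∀ s, m.inflow g ν s =
      a * m.inflow g (π₁.occupation g) s + b * m.inflow g (π₂.occupation g) s := by
    intro s
    simp only [inflow, hνdef, add_mul, ENNReal.tsum_add, mul_assoc, ENNReal.tsum_mul_left]
    calc _ = (a + b) * m.init s + g * (a * ∑' y, π₁.occupation g y * m.trans y.1 y.2 s +
            b * ∑' y, π₂.occupation g y * m.trans y.1 y.2 s) := by rw [hab, one_mul]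
      _ = _ := by ring
  have hrow : ∀ s, ∑' c, ν (s, c) = m.inflow g ν s := by
    intro s
    rw [hflow]
    simp only [hνdef]
    rw [ENNReal.tsum_add, ENNReal.tsum_mul_left, ENNReal.tsum_mul_left]
    congr 2
    · simp_rw [π₁.occupation_eq g (s, _)]
      rw [ENNReal.tsum_mul_left, PMF.tsum_coe, mul_one]
    · simp_rw [π₂.occupation_eq g (s, _)]
      rw [ENNReal.tsum_mul_left, PMF.tsum_coe, mul_one]
  have hrow_top : ∀ s, ∑' c, ν (s, c) ≠ ⊤ := by
    intro s
    refine ne_top_of_le_ne_top htop (hmass ▸ ?_)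
    rw [ENNReal.tsum_prod']
    exact ENNReal.le_tsum s
  -- The mixing policy is the conditional law of the action given the state under `ν`. States of
  -- zero weight may use any admissible law; `π₁` is taken there.
  let law : S → PMF A := fun s =>
    if h : ∑' c, ν (s, c) = 0 then π₁.law s
    else PMF.normalize (fun c => ν (s, c)) h (hrow_top s)
  have hlaw : ∀ x, ν x = m.inflow g ν x.1 * law x.1 x.2 := by
    rintro ⟨s, c⟩
    simp only [law]
    rw [← hrow]
    split_ifs with h
    · rw [h, zero_mul]
      exact ENNReal.tsum_eq_zero.1 h c
    · rw [PMF.normalize_apply, mul_comm, mul_assoc, ENNReal.inv_mul_cancel h (hrow_top s), mul_one]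
  let π : m.Policy :=
    { law := law
      support_subset := by
        intro s c hc
        by_cases h : ∑' c, ν (s, c) = 0
        · simp only [law, dif_pos h] at hc
          exact π₁.support_subset s hc
        · simp only [law, dif_neg h] at hc
          rw [PMF.mem_support_normalize_iff] at hc
          by_contra hcon
          have h₁ : π₁.law s c = 0 := (PMF.apply_eq_zero_iff _ _).2 fun h' =>
            hcon (π₁.support_subset s h')
          have h₂ : π₂.law s c = 0 := (PMF.apply_eq_zero_iff _ _).2 fun h' =>
            hcon (π₂.support_subset s h')
          apply hc
          simp only [hνdef]
          rw [π₁.occupation_eq, π₂.occupation_eq]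
          simp [h₁, h₂] }
  exact ⟨π, fun x => (congrFun (π.eq_occupation hg (ν := ν) hlaw hmass) x).symm⟩

theorem cost_nonneg (m : Agent S A) (x : S × A) : 0 ≤ m.cost x := by
  unfold cost; split_ifs <;> simp

theorem abs_cost_le_one (m : Agent S A) (x : S × A) : |m.cost x| ≤ 1 := by
  unfold cost; split_ifs <;> simp

/-! ### Discounted sums as integrals against the occupation measure -/

section Discounted

variable [MeasurableSpace S] [MeasurableSpace A]

/-- The discounted occupation measure. -/
noncomputable def Policy.occupationMeasure {m : Agent S A} (π : m.Policy) (g : ENNReal) :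
    Measure (S × A) :=
  Measure.sum fun t => g ^ t • (π.marginal t).toMeasure

theorem Policy.occupationMeasure_univ {m : Agent S A} (π : m.Policy) (g : ENNReal) :
    π.occupationMeasure g univ = (1 - g)⁻¹ := by
  rw [Policy.occupationMeasure, Measure.sum_apply _ MeasurableSet.univ]
  simp [ENNReal.tsum_geometric]

theorem Policy.isFiniteMeasure_occupationMeasure {m : Agent S A} (π : m.Policy) {γ : ℝ}
    (hγ1 : γ < 1) : IsFiniteMeasure (π.occupationMeasure (ENNReal.ofReal γ)) := by
  refine ⟨?_⟩
  rw [π.occupationMeasure_univ]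
  simp [hγ1]

variable [DiscreteMeasurableSpace S] [DiscreteMeasurableSpace A] [Countable S] [Countable A]

theorem Policy.map_eval_pathLaw {m : Agent S A} (π : m.Policy) (t : ℕ) :
    π.pathLaw.map (fun ω => ω t) = (π.marginal t).toMeasure := by
  induction t with
  | zero =>
    have h : (fun ω : ℕ → S × A => ω 0) =
        (MeasurableEquiv.piUnique fun _ : Finset.Iic 0 => S × A) ∘
          Preorder.frestrictLe (π := fun _ => S × A) 0 := rfl
    rw [h, ← Measure.map_map (by fun_prop) (by fun_prop), Policy.pathLaw, Kernel.trajMeasure,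
      Measure.map_comp _ _ (by fun_prop), Kernel.traj_map_frestrictLe, Kernel.partialTraj_self,
      Measure.id_comp, MeasurableEquiv.map_map_symm]
    rfl
  | succ t ih =>
    have h := Kernel.map_frestrictLe_trajMeasure_compProd_eq_map_trajMeasure
      (X := fun _ => S × A) (μ₀ := (π.pairLaw m.init).toMeasure)
      (κ := fun n => π.step.comap (fun h => h ⟨n, by simp⟩) (measurable_pi_apply _)) (a := t)
    have h2 := congrArg (Measure.map Prod.snd) h
    rw [Measure.map_map (by fun_prop) (by fun_prop)] at h2
    change _ = π.pathLaw.map (fun ω => ω (t + 1)) at h2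
    rw [← h2]
    change (Measure.snd _) = _
    rw [Measure.snd_compProd]
    -- The kernel sees only the last coordinate of the history, so the history can be replaced by
    -- its time-`t` marginal.
    rw [← Kernel.comp_deterministic_eq_comap, ← Measure.comp_assoc,
      Measure.deterministic_comp_eq_map, Measure.map_map (by fun_prop) (by fun_prop)]
    change π.step ∘ₘ (π.pathLaw.map (fun ω => ω t)) = _
    rw [ih]
    ext B hB
    rw [Measure.bind_apply hB (by fun_prop), Policy.marginal, PMF.toMeasure_bind_apply _ _ _ hB,
      lintegral_countable']
    refine tsum_congr fun x => ?_
    rw [PMF.toMeasure_apply_singleton _ _ (measurableSet_singleton _), mul_comm]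
    rfl

theorem Policy.occupationMeasure_singleton {m : Agent S A} (π : m.Policy) (g : ENNReal)
    (x : S × A) : π.occupationMeasure g {x} = π.occupation g x := by
  rw [Policy.occupationMeasure, Measure.sum_apply _ (measurableSet_singleton _)]
  simp [Policy.occupation, PMF.toMeasure_apply_singleton]

theorem Policy.integrable_occupationMeasure {m : Agent S A} (π : m.Policy) {γ : ℝ}
    (hγ1 : γ < 1) {f : S × A → ℝ} {M : ℝ} (hf : ∀ x, |f x| ≤ M) :
    Integrable f (π.occupationMeasure (ENNReal.ofReal γ)) := by
  have := π.isFiniteMeasure_occupationMeasure hγ1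
  exact Integrable.of_bound (by fun_prop) M (Filter.Eventually.of_forall hf)

theorem Policy.discounted_eq_integral {m : Agent S A} (π : m.Policy) {γ : ℝ} (hγ0 : 0 ≤ γ)
    (hγ1 : γ < 1) {f : S × A → ℝ} {M : ℝ} (hf : ∀ x, |f x| ≤ M) :
    π.discounted γ f = ∫ x, f x ∂π.occupationMeasure (ENNReal.ofReal γ) := by
  have hprob : IsProbabilityMeasure π.pathLaw := by
    unfold Policy.pathLaw; infer_instance
  have hint := π.integrable_occupationMeasure hγ1 hf
  rw [Policy.occupationMeasure] at hint ⊢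
  rw [integral_sum_measure hint, Policy.discounted]
  have hF : ∀ t : ℕ, Integrable (fun ω : ℕ → S × A => γ ^ t * f (ω t)) π.pathLaw := fun t =>
    by
    have hm : Measurable fun ω : ℕ → S × A => f (ω t) :=
      Measurable.of_discrete.comp (measurable_pi_apply t)
    exact (Integrable.of_bound hm.aestronglyMeasurable M
      (Filter.Eventually.of_forall fun ω => hf (ω t))).const_mul _
  rw [← integral_tsum_of_summable_integral_norm hF]
  · refine tsum_congr fun t => ?_
    rw [integral_smul_measure, ← π.map_eval_pathLaw, integral_map
      (measurable_pi_apply t).aemeasurable (by fun_prop), integral_const_mul]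
    simp [hγ0]
  · refine Summable.of_nonneg_of_le (fun t => integral_nonneg fun _ => norm_nonneg _) (fun t => ?_)
      ((summable_geometric_of_lt_one hγ0 hγ1).mul_right M)
    calc _ ≤ ∫ _, γ ^ t * M ∂π.pathLaw := by
          refine integral_mono (hF t).norm (integrable_const _) fun ω => ?_
          simp only [norm_mul, Real.norm_eq_abs, abs_pow, abs_of_nonneg hγ0]
          gcongr
          exact hf _
      _ = _ := by simp

theorem Policy.discounted_add_const_mul {m : Agent S A} (π : m.Policy) {γ : ℝ} (hγ0 : 0 ≤ γ)
    (hγ1 : γ < 1) {f h : S × A → ℝ} {M L : ℝ} (hf : ∀ x, |f x| ≤ M) (hh : ∀ x, |h x| ≤ L) (c : ℝ) :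
    π.discounted γ (fun x => f x + h x * c) = π.discounted γ f + c * π.discounted γ h := by
  have hb : ∀ x, |f x + h x * c| ≤ M + L * |c| := fun x => by
    refine (abs_add_le _ _).trans (add_le_add (hf x) ?_)
    rw [abs_mul]
    gcongr
    exact hh x
  rw [π.discounted_eq_integral hγ0 hγ1 hb, π.discounted_eq_integral hγ0 hγ1 hf,
    π.discounted_eq_integral hγ0 hγ1 hh, integral_add (π.integrable_occupationMeasure hγ1 hf)
      ((π.integrable_occupationMeasure hγ1 hh).mul_const c), integral_mul_const, mul_comm c]

theorem Policy.abs_discounted_le {m : Agent S A} (π : m.Policy) {γ : ℝ} (hγ0 : 0 ≤ γ)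
    (hγ1 : γ < 1) {f : S × A → ℝ} {M : ℝ} (hf : ∀ x, |f x| ≤ M) :
    |π.discounted γ f| ≤ M * (1 - γ)⁻¹ := by
  have := π.isFiniteMeasure_occupationMeasure hγ1
  rw [π.discounted_eq_integral hγ0 hγ1 hf]
  refine (norm_integral_le_of_norm_le_const (f := f) (C := M) (Filter.Eventually.of_forall hf)).trans ?_
  rw [Measure.real, π.occupationMeasure_univ, ENNReal.toReal_inv,
    ← ENNReal.ofReal_one, ← ENNReal.ofReal_sub _ hγ0, ENNReal.toReal_ofReal (by linarith)]

/-- The discounted values of two policies can be mixed by a stationary policy. -/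
theorem Policy.exists_discounted_eq {m : Agent S A} {γ : ℝ} (hγ0 : 0 ≤ γ) (hγ1 : γ < 1)
    (π₁ π₂ : m.Policy) {a b : ℝ} (ha : 0 ≤ a) (hb : 0 ≤ b) (hab : a + b = 1) :
    ∃ π : m.Policy, ∀ (f : S × A → ℝ) (M : ℝ), (∀ x, |f x| ≤ M) →
      π.discounted γ f = a * π₁.discounted γ f + b * π₂.discounted γ f := by
  have hg : ENNReal.ofReal γ < 1 := by simpa using hγ1
  obtain ⟨π, hπ⟩ := π₁.exists_occupation_eq π₂ hg
    (a := ENNReal.ofReal a) (b := ENNReal.ofReal b)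
    (by rw [← ENNReal.ofReal_add ha hb, hab, ENNReal.ofReal_one])
  have hμ : π.occupationMeasure (ENNReal.ofReal γ) =
      ENNReal.ofReal a • π₁.occupationMeasure (ENNReal.ofReal γ) +
        ENNReal.ofReal b • π₂.occupationMeasure (ENNReal.ofReal γ) := by
    refine Measure.ext_of_singleton fun x => ?_
    simp [Policy.occupationMeasure_singleton, hπ]
  refine ⟨π, fun f M hf => ?_⟩
  have h₁ := π₁.integrable_occupationMeasure hγ1 hf
  have h₂ := π₂.integrable_occupationMeasure hγ1 hf
  rw [π.discounted_eq_integral hγ0 hγ1 hf, π₁.discounted_eq_integral hγ0 hγ1 hf,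
    π₂.discounted_eq_integral hγ0 hγ1 hf, hμ,
    integral_add_measure (h₁.smul_measure ENNReal.ofReal_ne_top)
      (h₂.smul_measure ENNReal.ofReal_ne_top), integral_smul_measure, integral_smul_measure]
  simp [ha, hb]

theorem Policy.discounted_cost_nonneg {m : Agent S A} (π : m.Policy) {γ : ℝ} (hγ0 : 0 ≤ γ)
    (hγ1 : γ < 1) : 0 ≤ π.discounted γ m.cost := by
  rw [π.discounted_eq_integral hγ0 hγ1 m.abs_cost_le_one]
  exact integral_nonneg m.cost_nonneg

/-- Never choosing the crowded action is feasible and costs nothing. -/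
theorem exists_discounted_cost_eq_zero (m : Agent S A) {γ : ℝ} (hγ0 : 0 ≤ γ) (hγ1 : γ < 1) :
    ∃ π : m.Policy, π.discounted γ m.cost = 0 := by
  choose a ha hne using m.exists_ne_crowd
  let π : m.Policy :=
    { law := fun s => PMF.pure (a s)
      support_subset := fun s c hc => by
        rw [PMF.mem_support_pure_iff] at hc
        exact hc ▸ ha s }
  refine ⟨π, ?_⟩
  rw [π.discounted_eq_integral hγ0 hγ1 m.abs_cost_le_one]
  refine integral_eq_zero_of_ae ?_
  -- It suffices to check atoms of positive weight; by the flow equation their action has positive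
  -- probability, so it is `a s`.
  rw [Filter.EventuallyEq, ae_iff_of_countable]
  rintro ⟨s, c⟩ hx
  rw [π.occupationMeasure_singleton, π.occupation_eq] at hx
  have hc : PMF.pure (a s) c ≠ 0 := right_ne_zero_of_mul hx
  have : c = a s := by simpa using hc
  simp [cost, this, hne s]

end Discounted

end Agent

/-! ### Abstract convex programs: Lipschitz bounds and duality -/

/-- The optimal value `inf {U p + D K p | K p ≤ k}` of a constrained minimization problem. -/
noncomputable def constrainedValue {P : Type*} (U K : P → ℝ) (D k : ℝ) : ℝ :=
  sInf ((fun p => U p + D * K p) '' {p | K p ≤ k})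

/-- A pair of bounded functionals with convex joint range, the second one nonnegative and attaining
the value `0`. -/
structure IsConvexProgram {P : Type*} (U K : P → ℝ) (B C : ℝ) : Prop where
  bounded : ∀ p, |U p| ≤ B
  nonneg : ∀ p, 0 ≤ K p
  le : ∀ p, K p ≤ C
  exists_eq_zero : ∃ p, K p = 0
  mix : ∀ p q (a b : ℝ), 0 ≤ a → 0 ≤ b → a + b = 1 →
    ∃ r, U r = a * U p + b * U q ∧ K r = a * K p + b * K q

namespace IsConvexProgram

variable {P : Type*} {U K : P → ℝ} {B C : ℝ}

theorem bound_nonneg (h : IsConvexProgram U K B C) : 0 ≤ C := by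
  obtain ⟨p, hp⟩ := h.exists_eq_zero
  exact hp ▸ h.le p

theorem abs_objective_le (h : IsConvexProgram U K B C) (D : ℝ) (p : P) :
    |U p + D * K p| ≤ B + |D| * C := by
  refine (abs_add_le _ _).trans (add_le_add (h.bounded p) ?_)
  rw [abs_mul, abs_of_nonneg (h.nonneg p)]
  exact mul_le_mul_of_nonneg_left (h.le p) (abs_nonneg D)

theorem constrainedValue_le (h : IsConvexProgram U K B C) (D : ℝ) {k : ℝ} {p : P} (hp : K p ≤ k) :
    constrainedValue U K D k ≤ U p + D * K p := by
  refine csInf_le ⟨-(B + |D| * C), ?_⟩ ⟨p, hp, rfl⟩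
  rintro _ ⟨q, -, rfl⟩
  exact (abs_le.1 (h.abs_objective_le D q)).1

theorem le_constrainedValue (h : IsConvexProgram U K B C) {D k x : ℝ} (hk : 0 ≤ k)
    (hx : ∀ p, K p ≤ k → x ≤ U p + D * K p) : x ≤ constrainedValue U K D k := by
  obtain ⟨p, hp⟩ := h.exists_eq_zero
  refine le_csInf ⟨_, p, hp.le.trans hk, rfl⟩ ?_
  rintro _ ⟨q, hq, rfl⟩
  exact hx q hq

theorem abs_constrainedValue_le (h : IsConvexProgram U K B C) (D : ℝ) {k : ℝ} (hk : 0 ≤ k) :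
    |constrainedValue U K D k| ≤ B + |D| * C := by
  obtain ⟨p, hp⟩ := h.exists_eq_zero
  refine abs_le.2 ⟨h.le_constrainedValue hk fun q _ => (abs_le.1 (h.abs_objective_le D q)).1, ?_⟩
  exact (h.constrainedValue_le D (hp.le.trans hk)).trans (abs_le.1 (h.abs_objective_le D p)).2

theorem constrainedValue_le_add_left (h : IsConvexProgram U K B C) (D D' : ℝ) {k : ℝ}
    (hk : 0 ≤ k) : constrainedValue U K D k ≤ constrainedValue U K D' k + C * |D - D'| := by
  rw [← sub_le_iff_le_add]
  refine h.le_constrainedValue hk fun p hp => ?_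
  rw [sub_le_iff_le_add]
  refine (h.constrainedValue_le D hp).trans ?_
  have h1 : (D - D') * K p ≤ |D - D'| * C :=
    mul_le_mul (le_abs_self _) (h.le p) (h.nonneg p) (abs_nonneg _)
  linarith

theorem constrainedValue_anti (h : IsConvexProgram U K B C) (D : ℝ) {k k' : ℝ} (hk : 0 ≤ k)
    (hkk : k ≤ k') : constrainedValue U K D k' ≤ constrainedValue U K D k :=
  h.le_constrainedValue hk fun _ hp => h.constrainedValue_le D (hp.trans hkk)

/-- A point feasible for `k'` becomes feasible for `k` when mixed, with weight `k / k'`, with a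
point of zero cost. This bounds how fast the value can rise as the constraint tightens. -/
theorem constrainedValue_mul_le (h : IsConvexProgram U K B C) (D : ℝ) {k k' : ℝ} (hk : 0 < k)
    (hkk : k ≤ k') : k' * constrainedValue U K D k ≤
      k * constrainedValue U K D k' + (k' - k) * (B + |D| * C) := by
  obtain ⟨q, hq⟩ := h.exists_eq_zero
  have hk' : 0 < k' := hk.trans_le hkk
  rw [← sub_le_iff_le_add, ← div_le_iff₀' hk]
  refine h.le_constrainedValue hk'.le fun p hp => ?_
  rw [div_le_iff₀' hk, sub_le_iff_le_add]
  obtain ⟨r, hrU, hrK⟩ := h.mix p q (k / k') (1 - k / k') (by positivity)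
    (sub_nonneg.2 ((div_le_one hk').2 hkk)) (by ring)
  have hr : K r ≤ k := by
    rw [hrK, hq, mul_zero, add_zero]
    calc k / k' * K p ≤ k / k' * k' := by gcongr
      _ = k := by field_simp
  have h1 := mul_le_mul_of_nonneg_left (h.constrainedValue_le D hr) hk'.le
  have h2 := mul_le_mul_of_nonneg_left (abs_le.1 (h.abs_objective_le D q)).2 (sub_nonneg.2 hkk)
  have h3 : k' * (U r + D * K r) = k * (U p + D * K p) + (k' - k) * (U q + D * K q) := by
    rw [hrU, hrK]
    field_simp
    ring
  linarith

theorem constrainedValue_le_add_right (h : IsConvexProgram U K B C) {D δ R : ℝ} (hδ : 0 < δ)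
    (hD : |D| ≤ R) {k k' : ℝ} (hk : δ ≤ k) (hk' : δ ≤ k') :
    constrainedValue U K D k ≤ constrainedValue U K D k' + 2 * (B + R * C) / δ * |k - k'| := by
  have hk0 := hδ.trans_le hk
  have hk0' := hδ.trans_le hk'
  have hM := (abs_nonneg _).trans (h.abs_constrainedValue_le D hk0.le)
  have hMR : B + |D| * C ≤ B + R * C := by
    have := mul_le_mul_of_nonneg_right hD h.bound_nonneg
    linarith
  have hM' := hM.trans hMR
  -- Only `k ≤ k'` needs the mixing estimate; the other case is monotonicity.
  rcases le_total k k' with hkk | hkk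
  · have h1 := h.constrainedValue_mul_le D hk0 hkk
    have h2 := (abs_le.1 (h.abs_constrainedValue_le D hk0'.le)).1
    set v := constrainedValue U K D k
    set v' := constrainedValue U K D k'
    have h3 : k' * (v - v') ≤ (k' - k) * (2 * (B + R * C)) := by
      have : (k' - k) * (B + |D| * C - v') ≤ (k' - k) * (2 * (B + R * C)) :=
        mul_le_mul_of_nonneg_left (by linarith) (sub_nonneg.2 hkk)
      linarith
    have h4 : v - v' ≤ (k' - k) * (2 * (B + R * C)) / k' := by
      rwa [le_div_iff₀' hk0']
    have h5 : (k' - k) * (2 * (B + R * C)) / k' ≤ (k' - k) * (2 * (B + R * C)) / δ := by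
      have : 0 ≤ (k' - k) * (2 * (B + R * C)) :=
        mul_nonneg (sub_nonneg.2 hkk) (by linarith)
      gcongr
    rw [abs_sub_comm, abs_of_nonneg (sub_nonneg.2 hkk)]
    have h6 : (k' - k) * (2 * (B + R * C)) / δ = 2 * (B + R * C) / δ * (k' - k) := by ring
    linarith
  · have := h.constrainedValue_anti D hk0'.le hkk
    have : 0 ≤ 2 * (B + R * C) / δ * |k - k'| := by positivity
    linarith

theorem lipschitzOnWith_constrainedValue (h : IsConvexProgram U K B C) {δ R : ℝ} (hδ : 0 < δ) :
    ∃ L, LipschitzOnWith L (fun x : ℝ × ℝ => constrainedValue U K x.1 x.2)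
      {x | |x.1| ≤ R ∧ δ ≤ x.2} := by
  refine ⟨(C + 2 * (B + R * C) / δ).toNNReal, LipschitzOnWith.of_le_add_mul' _ ?_⟩
  rintro ⟨D, k⟩ ⟨hD, hk⟩ ⟨D', k'⟩ ⟨hD', hk'⟩
  simp only at *
  have hM : 0 ≤ B + R * C := by
    refine (abs_nonneg _).trans ((h.abs_constrainedValue_le D (hδ.le.trans hk)).trans ?_)
    have := mul_le_mul_of_nonneg_right hD h.bound_nonneg
    linarith
  have h1 := h.constrainedValue_le_add_left D D' (hδ.le.trans hk)
  have h2 := h.constrainedValue_le_add_right hδ hD' hk hk'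
  have h3 : C * |D - D'| ≤ C * dist (D, k) (D', k') :=
    mul_le_mul_of_nonneg_left (le_max_left _ _) h.bound_nonneg
  have h4 : 2 * (B + R * C) / δ * |k - k'| ≤ 2 * (B + R * C) / δ * dist (D, k) (D', k') :=
    mul_le_mul_of_nonneg_left (le_max_right _ _) (by positivity)
  linarith

/-- A Lagrange multiplier exists under Slater's condition. -/
theorem exists_multiplier (h : IsConvexProgram U K B C) (D : ℝ) {k : ℝ} (hk : 0 < k) :
    ∃ l, 0 ≤ l ∧ ∀ p, constrainedValue U K D k ≤ U p + D * K p + l * (K p - k) := by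
  set v := constrainedValue U K D k
  obtain ⟨q₀, hq₀⟩ := h.exists_eq_zero
  -- Infeasible points bound a multiplier from below and strictly feasible ones from above; the
  -- supremum of the lower bounds works. Inserting `0` makes it nonnegative.
  let slopes : Set ℝ := insert 0 ((fun p => (v - (U p + D * K p)) / (K p - k)) '' {p | k < K p})
  have hub : ∀ q, K q < k → (U q + D * K q - v) / (k - K q) ∈ upperBounds slopes := by
    intro q hq
    have hkq : 0 < k - K q := sub_pos.2 hq
    rintro _ (rfl | ⟨p, hp, rfl⟩)
    · exact div_nonneg (sub_nonneg.2 (h.constrainedValue_le D hq.le)) hkq.le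
    · have hp' : 0 < K p - k := sub_pos.2 hp
      have hs : 0 < K p - K q := by linarith
      simp only
      rw [div_le_div_iff₀ hp' hkq]
      -- The weights put the mixture exactly on `K r = k`, where its objective is at least `v`.
      obtain ⟨r, hrU, hrK⟩ := h.mix p q ((k - K q) / (K p - K q)) ((K p - k) / (K p - K q))
        (by positivity) (by positivity) (by field_simp; ring)
      have hr : K r = k := by
        rw [hrK]
        field_simp
        ring
      have h1 := h.constrainedValue_le D hr.le
      have h2 : (K p - K q) * (U r + D * K r) =
          (k - K q) * (U p + D * K p) + (K p - k) * (U q + D * K q) := by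
        rw [hrU, hrK]
        field_simp
        ring
      have h3 := mul_le_mul_of_nonneg_left h1 hs.le
      change (K p - K q) * v ≤ _ at h3
      linarith
  have hbdd : BddAbove slopes := ⟨_, hub q₀ (by rw [hq₀]; exact hk)⟩
  refine ⟨sSup slopes, le_csSup hbdd (mem_insert _ _), fun p => ?_⟩
  rcases lt_trichotomy (K p) k with hp | hp | hp
  · have h1 : sSup slopes ≤ _ := csSup_le (insert_nonempty _ _) (hub p hp)
    rw [le_div_iff₀ (sub_pos.2 hp)] at h1
    linarith
  · rw [hp, sub_self, mul_zero, add_zero, ← hp]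
    exact h.constrainedValue_le D hp.le
  · have h1 : _ ≤ sSup slopes := le_csSup hbdd (mem_insert_of_mem _ ⟨p, hp, rfl⟩)
    rw [div_le_iff₀ (sub_pos.2 hp)] at h1
    linarith

theorem iInf_iSup_eq (h : IsConvexProgram U K B C) (D : ℝ) {k : ℝ} (hk : 0 ≤ k) :
    (⨅ p, ⨆ l : {l : ℝ // 0 ≤ l}, ((U p + D * K p + l * (K p - k) : ℝ) : EReal)) =
      (constrainedValue U K D k : EReal) := by
  apply le_antisymm
  · refine EReal.le_of_forall_lt_iff_le.1 fun x hx => ?_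
    obtain ⟨p₀, hp₀⟩ := h.exists_eq_zero
    obtain ⟨_, ⟨p, hp, rfl⟩, hpx⟩ := exists_lt_of_csInf_lt
      (⟨_, p₀, hp₀.le.trans hk, rfl⟩ : ((fun p => U p + D * K p) '' {p | K p ≤ k}).Nonempty)
      (EReal.coe_lt_coe_iff.1 hx)
    refine (iInf_le _ p).trans (iSup_le fun l => EReal.coe_le_coe_iff.2 ?_)
    have := mul_nonneg l.2 (sub_nonneg.2 hp)
    simp only at hpx
    linarith
  · refine le_iInf fun p => ?_
    by_cases hp : K p ≤ k
    · refine le_iSup_of_le ⟨0, le_rfl⟩ (EReal.coe_le_coe_iff.2 ?_)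
      simpa using h.constrainedValue_le D hp
    · have hp' : 0 < K p - k := sub_pos.2 (not_le.1 hp)
      -- At an infeasible point this multiplier already lifts the Lagrangian to the constrained
      -- value.
      refine le_iSup_of_le ⟨|constrainedValue U K D k - (U p + D * K p)| / (K p - k),
        by positivity⟩ (EReal.coe_le_coe_iff.2 ?_)
      simp only
      rw [div_mul_cancel₀ _ hp'.ne']
      linarith [le_abs_self (constrainedValue U K D k - (U p + D * K p))]

theorem iSup_iInf_eq (h : IsConvexProgram U K B C) (D : ℝ) {k : ℝ} (hk : 0 < k) :
    (⨆ l : {l : ℝ // 0 ≤ l}, ⨅ p, ((U p + D * K p + l * (K p - k) : ℝ) : EReal)) =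
      (constrainedValue U K D k : EReal) := by
  apply le_antisymm
  · rw [← h.iInf_iSup_eq D hk.le]
    exact iSup_iInf_le_iInf_iSup _
  · obtain ⟨l, hl, hp⟩ := h.exists_multiplier D hk
    exact le_iSup_of_le ⟨l, hl⟩ (le_iInf fun p => EReal.coe_le_coe_iff.2 (hp p))

end IsConvexProgram

/-! ### Application to agents, and almost everywhere differentiability -/

theorem Agent.isConvexProgram {S A : Type*} [MeasurableSpace S] [MeasurableSpace A]
    [DiscreteMeasurableSpace S] [DiscreteMeasurableSpace A] [Countable S] [Countable A]
    (m : Agent S A) {γ : ℝ} (hγ0 : 0 ≤ γ) (hγ1 : γ < 1) {M : ℝ}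
    (hM : ∀ s a, |m.utility s a| ≤ M) :
    IsConvexProgram (fun π : m.Policy => π.discounted γ fun x => m.utility x.1 x.2)
      (fun π : m.Policy => π.discounted γ m.cost) (M * (1 - γ)⁻¹) (1 * (1 - γ)⁻¹) where
  bounded π := π.abs_discounted_le hγ0 hγ1 fun x => hM x.1 x.2
  nonneg π := π.discounted_cost_nonneg hγ0 hγ1
  le π := (le_abs_self _).trans (π.abs_discounted_le hγ0 hγ1 m.abs_cost_le_one)
  exists_eq_zero := m.exists_discounted_cost_eq_zero hγ0 hγ1
  mix π₁ π₂ a b ha hb hab := by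
    obtain ⟨π, hπ⟩ := Agent.Policy.exists_discounted_eq hγ0 hγ1 π₁ π₂ ha hb hab
    exact ⟨π, hπ _ M fun x => hM x.1 x.2, hπ _ 1 m.abs_cost_le_one⟩

theorem IsCongestionPenalty.contDiffAt {d : ℝ → ℝ} (hd : IsCongestionPenalty d) {x : ℝ}
    (hx : 1 < x) : ContDiffAt ℝ 1 d x := by
  have h : ContDiffOn ℝ (0 + 1) d (Ioi 1) := by
    rw [contDiffOn_succ_iff_deriv_of_isOpen isOpen_Ioi]
    exact ⟨hd.differentiableOn, by simp, contDiffOn_zero.2 hd.differentiableOn_deriv.continuousOn⟩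
  rw [zero_add] at h
  exact h.contDiffAt (Ioi_mem_nhds hx)

theorem IsCongestionPenalty.contDiffAt_othersSum {d : ℝ → ℝ} (hd : IsCongestionPenalty d) {N : ℕ}
    (i : Fin N) {θ : Fin N → ℝ} (hθ : ∀ j, 0 < θ j) :
    ContDiffAt ℝ 1 (fun θ => d (1 + othersSum θ i)) θ := by
  -- Without other agents the argument of `d` is the end point `1`, where `d` need not be
  -- differentiable, but the function is constant.
  rcases (Finset.univ.erase i).eq_empty_or_nonempty with h | h
  · simp only [othersSum, h, Finset.sum_empty]
    exact contDiffAt_const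
  · have hpos : 0 < othersSum θ i := Finset.sum_pos (fun j _ => hθ j) h
    refine ContDiffAt.comp θ (g := d) (f := fun θ => 1 + othersSum θ i)
      (hd.contDiffAt (by linarith)) ?_
    unfold othersSum
    fun_prop

/-- **Rademacher's theorem** for functions that are Lipschitz near almost every point of a set. -/
theorem ae_differentiableAt_of_locally_lipschitz {E : Type*} [NormedAddCommGroup E]
    [NormedSpace ℝ E] [FiniteDimensional ℝ E] [MeasurableSpace E] [BorelSpace E] (μ : Measure E)
    [μ.IsAddHaarMeasure] {f : E → ℝ} {s : Set E}
    (hf : ∀ x ∈ s, ∃ L, ∃ t ∈ nhds x, LipschitzOnWith L f t) :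
    ∀ᵐ x ∂μ, x ∈ s → DifferentiableAt ℝ f x := by
  rw [ae_iff]
  refine measure_null_of_locally_null _ fun x hx => ?_
  simp only [mem_ofPred_eq, Classical.not_imp] at hx
  obtain ⟨L, t, ht, hL⟩ := hf x hx.1
  obtain ⟨u, hut, hu, hxu⟩ := mem_nhds_iff.1 ht
  refine ⟨{y | ¬(y ∈ u → DifferentiableWithinAt ℝ f u y)}, ?_,
    ae_iff.1 ((hL.mono hut).ae_differentiableWithinAt_of_mem (μ := μ))⟩
  filter_upwards [self_mem_nhdsWithin, mem_nhdsWithin_of_mem_nhds (hu.mem_nhds hxu)] with y hy hyu hd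
  exact hy fun _ => (hd hyu).differentiableAt (hu.mem_nhds hyu)

/-- The coordinate hyperplanes are null. -/
theorem ae_pos_of_nonneg_orthant {N : ℕ} :
    ∀ᵐ θ ∂(volume.restrict {θ : Fin N → ℝ | ∀ j, 0 ≤ θ j}), ∀ j, 0 < θ j := by
  have hmeas : MeasurableSet {θ : Fin N → ℝ | ∀ j, 0 ≤ θ j} := by
    simp only [ofPred_forall]
    exact MeasurableSet.iInter fun j => measurableSet_le measurable_const (measurable_pi_apply j)
  rw [ae_restrict_iff' hmeas]
  have h0 : ∀ᵐ θ : Fin N → ℝ, ∀ j, θ j ≠ 0 := ae_all_iff.2 fun j =>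
    (Measure.quasiMeasurePreserving_eval (fun _ : Fin N => (volume : Measure ℝ)) j).ae
      (measure_eq_zero_iff_ae_notMem.1 (measure_singleton (0 : ℝ)))
  filter_upwards [h0] with θ hθ hnonneg j
  exact (hnonneg j).lt_of_ne' (hθ j)

section System

variable {N : ℕ} {S A : Fin N → Type*} [∀ i, MeasurableSpace (S i)] [∀ i, MeasurableSpace (A i)]
  [∀ i, DiscreteMeasurableSpace (S i)] [∀ i, DiscreteMeasurableSpace (A i)]
  [∀ i, Countable (S i)] [∀ i, Countable (A i)]

theorem lagrangian_eq (m : ∀ i, Agent (S i) (A i)) (d : ℝ → ℝ) {γ : ℝ} (hγ0 : 0 ≤ γ)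
    (hγ1 : γ < 1) (i : Fin N) (θ : Fin N → ℝ) (l : ℝ) (π : (m i).Policy) :
    lagrangian m d γ i θ l π =
      π.discounted γ (fun x => (m i).utility x.1 x.2) +
        d (1 + othersSum θ i) * π.discounted γ (m i).cost +
        l * (π.discounted γ (m i).cost - θ i) := by
  obtain ⟨M, hM⟩ := (m i).utility_bdd
  rw [lagrangian, ← π.discounted_add_const_mul hγ0 hγ1 (fun x => hM x.1 x.2) (m i).abs_cost_le_one]
  rfl

theorem lagrangianValueE_eq (m : ∀ i, Agent (S i) (A i)) (d : ℝ → ℝ) {γ : ℝ} (hγ0 : 0 ≤ γ)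
    (hγ1 : γ < 1) (i : Fin N) {θ : Fin N → ℝ} (hθ : 0 ≤ θ i) :
    lagrangianValueE m d γ i θ =
      (constrainedValue (fun π : (m i).Policy => π.discounted γ fun x => (m i).utility x.1 x.2)
        (fun π => π.discounted γ (m i).cost) (d (1 + othersSum θ i)) (θ i) : EReal) := by
  obtain ⟨M, hM⟩ := (m i).utility_bdd
  simp only [lagrangianValueE, lagrangian_eq m d hγ0 hγ1]
  exact ((m i).isConvexProgram hγ0 hγ1 hM).iInf_iSup_eq _ hθ

theorem lagrangianValue_eq (m : ∀ i, Agent (S i) (A i)) (d : ℝ → ℝ) {γ : ℝ} (hγ0 : 0 ≤ γ)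
    (hγ1 : γ < 1) (i : Fin N) {θ : Fin N → ℝ} (hθ : 0 ≤ θ i) :
    lagrangianValue m d γ i θ =
      constrainedValue (fun π : (m i).Policy => π.discounted γ fun x => (m i).utility x.1 x.2)
        (fun π => π.discounted γ (m i).cost) (d (1 + othersSum θ i)) (θ i) := by
  rw [lagrangianValue, lagrangianValueE_eq m d hγ0 hγ1 i hθ, EReal.toReal_coe]

theorem exists_lipschitzOnWith_lagrangianValue (m : ∀ i, Agent (S i) (A i)) {d : ℝ → ℝ}
    (hd : IsCongestionPenalty d) {γ : ℝ} (hγ0 : 0 ≤ γ) (hγ1 : γ < 1) (i : Fin N)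
    {θ : Fin N → ℝ} (hθ : ∀ j, 0 < θ j) :
    ∃ L, ∃ t ∈ nhds θ, LipschitzOnWith L (lagrangianValue m d γ i) t := by
  obtain ⟨M, hM⟩ := (m i).utility_bdd
  have hg : ContDiffAt ℝ 1 (fun θ : Fin N → ℝ => (d (1 + othersSum θ i), θ i)) θ :=
    (hd.contDiffAt_othersSum i hθ).prodMk (by fun_prop)
  obtain ⟨L₁, t, ht, hL₁⟩ := hg.exists_lipschitzOnWith
  -- Near `θ`, continuity keeps `|D|` below its value plus one and `θ i` above half its value, so
  -- one Lipschitz constant serves a whole neighbourhood.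
  obtain ⟨L₂, hL₂⟩ := ((m i).isConvexProgram hγ0 hγ1 hM).lipschitzOnWith_constrainedValue
    (R := |d (1 + othersSum θ i)| + 1) (half_pos (hθ i))
  have h1 : ∀ᶠ θ' in nhds θ, |d (1 + othersSum θ' i)| < |d (1 + othersSum θ i)| + 1 :=
    (hg.continuousAt.fst.abs).eventually_lt_const (lt_add_one _)
  have h2 : ∀ᶠ θ' in nhds θ, θ i / 2 < θ' i :=
    (continuous_apply i).continuousAt.eventually_const_lt (half_lt_self (hθ i))
  refine ⟨L₂ * L₁, _, Filter.inter_mem ht (h1.and h2), ?_⟩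
  have hcomp := hL₂.comp (hL₁.mono inter_subset_left)
    fun θ' (hθ' : θ' ∈ t ∩ {θ' | |d (1 + othersSum θ' i)| < |d (1 + othersSum θ i)| + 1 ∧
      θ i / 2 < θ' i}) => ⟨hθ'.2.1.le, hθ'.2.2.le⟩
  have heq : ∀ θ' : Fin N → ℝ, θ i / 2 < θ' i → _ := fun θ' hθ' =>
    lagrangianValue_eq m d hγ0 hγ1 i ((half_pos (hθ i)).le.trans hθ'.le)
  intro x hx y hy
  rw [heq x hx.2.2, heq y hy.2.2]
  exact hcomp hx hy

end System

theorem mainTheorem4 {N : ℕ} {S A : Fin N → Type*}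
    [∀ i, MeasurableSpace (S i)] [∀ i, MeasurableSpace (A i)]
    [∀ i, DiscreteMeasurableSpace (S i)] [∀ i, DiscreteMeasurableSpace (A i)]
    [∀ i, Countable (S i)] [∀ i, Countable (A i)]
    (m : ∀ i, Agent (S i) (A i)) (d : ℝ → ℝ) (hd : IsCongestionPenalty d)
    (γ : ℝ) (hγ0 : 0 ≤ γ) (hγ1 : γ < 1) (i : Fin N) :
    (∀ θ : Fin N → ℝ, (∀ j, 0 ≤ θ j) → 0 < θ i →
      lagrangianValueE m d γ i θ = (lagrangianValue m d γ i θ : EReal) ∧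
      (⨆ l : {l : ℝ // 0 ≤ l}, ⨅ π : (m i).Policy, (lagrangian m d γ i θ l π : EReal)) =
        (lagrangianValue m d γ i θ : EReal)) ∧
    ∀ᵐ θ ∂(volume.restrict {θ : Fin N → ℝ | ∀ j, 0 ≤ θ j}),
      DifferentiableAt ℝ (lagrangianValue m d γ i) θ := by
  obtain ⟨M, hM⟩ := (m i).utility_bdd
  refine ⟨fun θ _ hθi => ⟨?_, ?_⟩, ?_⟩
  · rw [lagrangianValueE_eq m d hγ0 hγ1 i hθi.le, lagrangianValue_eq m d hγ0 hγ1 i hθi.le]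
  · rw [lagrangianValue_eq m d hγ0 hγ1 i hθi.le]
    simp only [lagrangian_eq m d hγ0 hγ1]
    exact ((m i).isConvexProgram hγ0 hγ1 hM).iSup_iInf_eq _ hθi
  · have h := ae_differentiableAt_of_locally_lipschitz volume (s := {θ : Fin N → ℝ | ∀ j, 0 < θ j})
      fun θ hθ => exists_lipschitzOnWith_lagrangianValue m hd hγ0 hγ1 i hθ
    filter_upwards [ae_restrict_of_ae h, ae_pos_of_nonneg_orthant] with θ hθ hpos
    exact hθ hpos
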